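/- **Model.** Let $G=(V,w)$ be a finite metric space with diameter $\Delta(G)$. A request sequence $\sigma$ is a finite sequence of requests $([r_i,d_i],v_i)$ with $r_i,d_i$ positive integers and $v_i\in V$. Serving a request takes one unit of time and travelling from $u$ to $v$ takes time $w(u,v)$. A schedule is valid if every request $i$ that it serves is served during an interval $[t_i,t_i+1]\subseteq[r_i,d_i]$, and for any two served requests $i\ne j$ either $t_i+1+w(v_i,v_j)\le t_j$ or $t_j+1+w(v_j,v_i)\le t_i$. Its throughput is the number of requests that it serves; $\mathrm{OPT}(\sigma)$ is the largest throughput of a valid schedule. Let $L=\min_i(d_i-r_i)$ be the minimum laxity of $\sigma$. **Algorithm ORIENT-WINDOW.** The server starts at time $0$ at an arbitrary node $v_0$. Let $K=3\Delta(G)$; phase $\ell=1,2,\dots$ lasts from time $K(\ell-1)$ to $K\ell$. At time $K(\ell-1)$ let $R^\ell$ be the set of all requests $([r,d],v)$ that are still unserved, with $r\le K(\ell-1)$ and decreased deadline $K\lfloor d/K\rfloor\ge K\ell$, and let $S^\ell_v\subseteq R^\ell$ be those at node $v$. Use a (deterministic) $c$-approximation algorithm for the unrooted orienteering problem with budget $\Delta(G)$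 and prizes $|S^\ell_v|$: it returns a path $v_{i_1},\dots,v_{i_r}$ of distinct nodes of total distance at most $\Delta(G)$ such that every path of distinct nodes of total distance at most $\Delta(G)$ has total prize at most $c$ times that of the returned path. During the phase, serve the requests of $S^\ell_{v_{i_1}}$ (in the order of their numbers in $\sigma$), then those of $S^\ell_{v_{i_2}}$, and so on, travelling directly from each request to the next; at the first request that cannot be reached and completely served by time $K\ell$, the rest of this order is abandoned (these requests remain unserved and may be considered again in later phases). **Theorem.** Let $\Delta(G)\ge \tfrac12$. Then ORIENT-WINDOW is a deterministic online algorithm (for every $T$, the services that it starts up to time $T$ depend only on the requests released up to time $T$), and for every request sequence $\sigma$ with $L>9\Delta(G)$ its schedule is valid and its throughput $\mathrm{ALG}(\sigma)$ satisfies $$\mathrm{OPT}(\sigma)\le \bigl(9\max(c,3)+1\bigr)\,\mathrm{ALG}(\sigma).$$ Thus the competitive ratio is $O(1)$ for every constant-factor orienteering algorithm, and it is at most $28$ when a $3$-approximation (or better) is used. -/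

import Mathlib

namespace TSPWindows

/-- A request `([r, d], v)`: arrival time and deadline are positive integers, `v` is a node. -/
structure Request (V : Type*) where
  release : ℕ+
  deadline : ℕ+
  node : V

/-- The arrival time as a real number. -/
def Request.r {V : Type*} (q : Request V) : ℝ := ((q.release : ℕ) : ℝ)

/-- The deadline as a real number. -/
def Request.d {V : Type*} (q : Request V) : ℝ := ((q.deadline : ℕ) : ℝ)

/-- The minimum laxity `L = min_i (d_i - r_i)` of a finite request sequence
(`⊤` for the empty sequence). -/
noncomputable def minLaxity {V : Type*} (σ : List (Request V)) : EReal :=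
  ⨅ q ∈ σ, ((q.d - q.r : ℝ) : EReal)

/-- A schedule for a request sequence: `S j = some t` means that the service of the `j`-th request
(numbered from `0`) takes place during `[t, t + 1]`; `S j = none` means that it is not served. -/
abbrev Schedule : Type := ℕ → Option ℝ

/-- A schedule is valid if it serves only requests of the sequence, each of them (one unit of
time) within its window, and leaves between any two services the time to travel. -/
def Valid {V : Type*} [MetricSpace V] (σ : List (Request V)) (S : Schedule) : Prop :=
  (∀ j t, S j = some t → ∃ q, σ[j]? = some q ∧ q.r ≤ t ∧ t + 1 ≤ q.d) ∧
  (∀ i j p q s t, i ≠ j → σ[i]? = some p → σ[j]? = some q → S i = some s → S j = some t →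
    s + 1 + dist p.node q.node ≤ t ∨ t + 1 + dist q.node p.node ≤ s)

/-- The number of requests of `σ` that are served. -/
def throughput {V : Type*} (σ : List (Request V)) (S : Schedule) : ℕ :=
  ((Finset.range σ.length).filter (fun j => (S j).isSome)).card

/-- The optimal (offline) throughput. -/
noncomputable def opt {V : Type*} [MetricSpace V] (σ : List (Request V)) : ℕ :=
  sSup {k | ∃ S, Valid σ S ∧ throughput σ S = k}

theorem throughput_le_length {V : Type*} (σ : List (Request V)) (S : Schedule) :
    throughput σ S ≤ σ.length := by
  unfold throughput
  exact (Finset.card_filter_le _ _).trans (by simp)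

theorem throughput_le_opt {V : Type*} [MetricSpace V] {σ : List (Request V)} {S : Schedule}
    (h : Valid σ S) : throughput σ S ≤ opt σ := by
  refine le_csSup ⟨σ.length, ?_⟩ ⟨S, h, rfl⟩
  rintro k ⟨S', -, rfl⟩
  exact throughput_le_length σ S'

theorem exists_valid_throughput_eq_opt {V : Type*} [MetricSpace V] (σ : List (Request V)) :
    ∃ S, Valid σ S ∧ throughput σ S = opt σ := by
  have hne : {k | ∃ S, Valid σ S ∧ throughput σ S = k}.Nonempty :=
    ⟨_, fun _ => none, ⟨by simp, by simp⟩, rfl⟩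
  refine Nat.sSup_mem hne ⟨σ.length, ?_⟩
  rintro k ⟨S', -, rfl⟩
  exact throughput_le_length σ S'

/-- Two request sequences coincide as far as the requests released up to time `T` go. -/
def AgreeUpTo {V : Type*} (T : ℝ) (σ τ : List (Request V)) : Prop :=
  ∀ (j : ℕ) (q : Request V), q.r ≤ T → (σ[j]? = some q ↔ τ[j]? = some q)

/-- A deterministic algorithm is online if the services that it starts up to time `T` depend only
on the requests that are released up to time `T`. -/
def IsOnline {V : Type*} (A : List (Request V) → Schedule) : Prop :=
  ∀ (T : ℝ) (σ τ : List (Request V)), AgreeUpTo T σ τ →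
    ∀ (j : ℕ) (t : ℝ), t ≤ T → (A σ j = some t ↔ A τ j = some t)

/-- The diameter `Δ(G)`. -/
noncomputable def diameter (V : Type*) [MetricSpace V] : ℝ :=
  Metric.diam (Set.univ : Set V)

/-! ### The unrooted orienteering problem -/

/-- The total distance along a list of nodes. -/
noncomputable def pathLength {V : Type*} [MetricSpace V] : List V → ℝ
  | [] => 0
  | [_] => 0
  | a :: b :: l => dist a b + pathLength (b :: l)

/-- The total prize of the nodes of a path. -/
def prize {V : Type*} (π : V → ℕ) (l : List V) : ℕ := (l.map π).sum

/-- A feasible solution of the unrooted orienteering problem with budget `B`: a path, with no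
prescribed end points, of total distance at most `B`. -/
def OrienteeringPath {V : Type*} [MetricSpace V] (B : ℝ) (l : List V) : Prop :=
  l.Nodup ∧ pathLength l ≤ B

/-- `solve` is a `c`-approximation algorithm for the unrooted orienteering problem with
budget `B`: for all prizes it returns a feasible path, whose total prize is at least `1 / c` times
that of any feasible path. -/
def IsOrienteeringApprox {V : Type*} [MetricSpace V] (c B : ℝ) (solve : (V → ℕ) → List V) : Prop :=
  ∀ π : V → ℕ, OrienteeringPath B (solve π) ∧
    ∀ l : List V, OrienteeringPath B l → (prize π l : ℝ) ≤ c * (prize π (solve π) : ℝ)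

/-! ### Algorithm ORIENT-WINDOW

Phases are numbered from `0`: phase `ℓ` is the time from `K * ℓ` to `K * (ℓ + 1)`, where
`K = 3 * Δ(G)`. -/

/-- The length `K = 3 * Δ(G)` of a phase. -/
noncomputable def phaseLength (V : Type*) [MetricSpace V] : ℝ := 3 * diameter V

/-- The decreased deadline `K * ⌊d / K⌋`. -/
noncomputable def decreasedDeadline {V : Type*} [MetricSpace V] (q : Request V) : ℝ :=
  phaseLength V * (⌊q.d / phaseLength V⌋₊ : ℝ)

open Classical in
/-- The requests considered in phase `ℓ`, with their numbers, where `S` records the services before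
the phase: those that have arrived when the phase begins, are still unserved, and whose decreased
deadline is not before the end of the phase. -/
noncomputable def pending {V : Type*} [MetricSpace V] (σ : List (Request V)) (S : Schedule)
    (ℓ : ℕ) : List (Request V × ℕ) :=
  σ.zipIdx.filter (fun x => decide (x.1.r ≤ phaseLength V * (ℓ : ℝ) ∧ S x.2 = none ∧
    phaseLength V * ((ℓ : ℝ) + 1) ≤ decreasedDeadline x.1))

open Classical in
/-- The members of `R` at node `v`. -/
noncomputable def atNode {V : Type*} (R : List (Request V × ℕ)) (v : V) :
    List (Request V × ℕ) :=
  R.filter (fun x => decide (x.1.node = v))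

/-- The order in which the requests of `R` are to be served: node by node, along the solution of
the orienteering problem in which the prize of a node is its number of requests in `R`. -/
noncomputable def plan {V : Type*} (solve : (V → ℕ) → List V) (R : List (Request V × ℕ)) :
    List (Request V × ℕ) :=
  (solve (fun v => (atNode R v).length)).flatMap (fun v => atNode R v)

open Classical in
/-- Serve a queue, the server being at `p` at time `t` and `S` being the record of services so far.
As soon as the next request cannot be reached and served by time `E`, the rest of the
queue is dropped. The result is the new position and the new record. -/
noncomputable def serveQueue {V : Type*} [MetricSpace V] (E : ℝ) :
    List (Request V × ℕ) → V → ℝ → Schedule → V × Schedule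
  | [], p, _, S => (p, S)
  | x :: ρ, p, t, S =>
    if t + dist p x.1.node + 1 ≤ E then
      serveQueue E ρ x.1.node (t + dist p x.1.node + 1)
        (Function.update S x.2 (some (t + dist p x.1.node)))
    else (p, S)

/-- Position of the server and record of services at the beginning of phase `ℓ`, the server being
at `v₀` at time `0`. -/
noncomputable def state {V : Type*} [MetricSpace V] (solve : (V → ℕ) → List V) (v₀ : V)
    (σ : List (Request V)) : ℕ → V × Schedule
  | 0 => (v₀, fun _ => none)
  | ℓ + 1 =>
    serveQueue (phaseLength V * ((ℓ : ℝ) + 1))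
      (plan solve (pending σ (state solve v₀ σ ℓ).2 ℓ))
      (state solve v₀ σ ℓ).1 (phaseLength V * (ℓ : ℝ)) (state solve v₀ σ ℓ).2

open Classical in
/-- The schedule produced by ORIENT-WINDOW: the services recorded in all the phases. -/
noncomputable def orientWindow {V : Type*} [MetricSpace V] (solve : (V → ℕ) → List V) (v₀ : V)
    (σ : List (Request V)) : Schedule := fun j =>
  if h : ∃ ℓ, ((state solve v₀ σ ℓ).2 j).isSome then (state solve v₀ σ (Nat.find h)).2 j else none

end TSPWindows

namespace TSPWindows

open Classical

variable {V : Type*} [MetricSpace V]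

/-! ### Path lengths -/

/-! The bound is a charging argument against an optimal schedule `O`. Put `Δ = diameter V` and `K =
3Δ`. A request that the algorithm never serves is pending in every phase lying between its release
and its decreased deadline. Since its laxity exceeds `3K`, there is such a phase `ℓ` for which `O`
serves it at a time in `[K(ℓ-1), K(ℓ+2))` (`exists_phase_near`). This interval splits into nine
windows of length `Δ`, and the request is charged to the phase and the window.

The requests charged to one window number fewer than `Δ + 1`, since each takes unit time, and their
nodes form an orienteering path of length at most `Δ` (`exists_orienteeringPath`). So the plan of
phase `ℓ` contains at least a `1/c` fraction of them when `c > 0`. A phase has time `Δ` to reach the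
path, `Δ` to follow it and `Δ` for services. It therefore serves the whole plan or, if that is
longer than `Δ`, at least `max(⌊Δ⌋, 1)` requests (`throughput_state_add_le`). Either way a window is
paid for at rate `max c 3` (`card_le_of_pending`). Nine windows per phase, summed over phases, plus
the requests served by both, give `9 * max c 3 + 1`.

Validity rests on the invariant `Reachable`; being online rests on each phase using only requests
released by its start. -/

theorem pathLength_nonneg : ∀ l : List V, 0 ≤ pathLength l
  | [] => le_rfl
  | [_] => le_rfl
  | _ :: b :: l => add_nonneg dist_nonneg (pathLength_nonneg (b :: l))

theorem pathLength_le_cons (a : V) (l : List V) : pathLength l ≤ pathLength (a :: l) := by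
  cases l with
  | nil => exact le_rfl
  | cons b l => exact le_add_of_nonneg_left dist_nonneg

theorem pathLength_cons_le_dist_add (a b : V) (l : List V) :
    pathLength (a :: l) ≤ dist a b + pathLength (b :: l) := by
  cases l with
  | nil => simp [pathLength]
  | cons x l =>
    simp only [pathLength]
    linarith [dist_triangle a b x]

/-- Skipping a node is a shortcut by the triangle inequality. The common first node, kept arbitrary,
is what lets the induction pass through a skipped node. -/
theorem pathLength_cons_mono {l₁ l₂ : List V} (h : l₁.Sublist l₂) :
    ∀ a, pathLength (a :: l₁) ≤ pathLength (a :: l₂) := by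
  induction h with
  | slnil => exact fun _ => le_rfl
  | @cons l₁ l₂ b _ ih =>
    intro a
    calc pathLength (a :: l₁) ≤ dist a b + pathLength (b :: l₁) :=
          pathLength_cons_le_dist_add a b l₁
      _ ≤ dist a b + pathLength (b :: l₂) := by gcongr; exact ih b
  | @cons_cons l₁ l₂ b _ ih =>
    intro a
    simp only [pathLength]
    gcongr
    exact ih b

theorem pathLength_mono {l₁ l₂ : List V} (h : l₁.Sublist l₂) :
    pathLength l₁ ≤ pathLength l₂ := by
  cases h with
  | slnil => exact le_rfl
  | @cons l₁ l₂ b h =>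
    exact (pathLength_le_cons b l₁).trans (pathLength_cons_mono h b)
  | @cons_cons l₁ l₂ b h => exact pathLength_cons_mono h b

theorem pathLength_cons_replicate_append (v : V) (n : ℕ) (l : List V) :
    pathLength (v :: (List.replicate n v ++ l)) = pathLength (v :: l) := by
  induction n with
  | zero => simp
  | succ n ih => simpa [List.replicate_succ, pathLength] using ih

/-- Repeated services at one node cost no travel. Equality can fail because nodes with `n v = 0` are
skipped. -/
theorem pathLength_cons_flatMap_replicate (n : V → ℕ) (l : List V) :
    ∀ a, pathLength (a :: l.flatMap (fun v => List.replicate (n v) v)) ≤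
      pathLength (a :: l) := by
  induction l with
  | nil => simp
  | cons v l ih =>
    intro a
    rw [List.flatMap_cons]
    refine (pathLength_cons_le_dist_add a v _).trans ?_
    rw [pathLength_cons_replicate_append]
    simp only [pathLength]
    gcongr
    exact ih v

theorem dist_le_diameter [Fintype V] (x y : V) : dist x y ≤ diameter V :=
  Metric.dist_le_diam_of_mem Set.finite_univ.isBounded (Set.mem_univ x) (Set.mem_univ y)

/-- Services that are separated by the travel times and that all start by time `E` leave room for
the path that connects them. -/
theorem add_length_add_pathLength_le {f : ℕ → ℝ} {g : ℕ → V} {E : ℝ} {l : List ℕ} :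
    ∀ {a : ℕ}, (a :: l).Pairwise (fun i j => f i + 1 + dist (g i) (g j) ≤ f j) →
      (∀ i ∈ a :: l, f i ≤ E) →
      f a + l.length + pathLength ((a :: l).map g) ≤ E := by
  induction l with
  | nil => intro a _ h; simpa [pathLength] using h
  | cons b l ih =>
    intro a hp hE
    have h₁ := ih (List.pairwise_cons.1 hp).2 (fun i hi => hE i (List.mem_cons_of_mem _ hi))
    have h₂ := (List.pairwise_cons.1 hp).1 b List.mem_cons_self
    simp only [List.map_cons, pathLength, List.length_cons] at h₁ ⊢
    push_cast
    linarith

/-! ### The queue of a phase -/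

theorem serveQueue_isSome {E : ℝ} {ρ : List (Request V × ℕ)} :
    ∀ {p : V} {t : ℝ} {S : Schedule} {j : ℕ}, (S j).isSome →
      ((serveQueue E ρ p t S).2 j).isSome := by
  induction ρ with
  | nil => intro p t S j h; exact h
  | cons x ρ ih =>
    intro p t S j h
    rw [serveQueue]
    split_ifs
    · refine ih ?_
      by_cases hj : j = x.2
      · subst hj; simp
      · simpa [hj] using h
    · exact h

theorem serveQueue_of_notMem {E : ℝ} {ρ : List (Request V × ℕ)} {j : ℕ} :
    ∀ {p : V} {t : ℝ} {S : Schedule}, (∀ x ∈ ρ, x.2 ≠ j) →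
      (serveQueue E ρ p t S).2 j = S j := by
  induction ρ with
  | nil => intro p t S _; rfl
  | cons x ρ ih =>
    intro p t S h
    rw [serveQueue]
    split_ifs
    · rw [ih fun y hy => h y (List.mem_cons_of_mem _ hy)]
      exact Function.update_of_ne (h x List.mem_cons_self).symm _ _
    · rfl

theorem serveQueue_eq_some {E : ℝ} {ρ : List (Request V × ℕ)} {j : ℕ} {s : ℝ} :
    ∀ {p : V} {t : ℝ} {S : Schedule}, (serveQueue E ρ p t S).2 j = some s →
      S j = some s ∨ ∃ x ∈ ρ, x.2 = j ∧ t ≤ s ∧ s + 1 ≤ E := by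
  induction ρ with
  | nil => intro p t S h; exact Or.inl h
  | cons x ρ ih =>
    intro p t S h
    rw [serveQueue] at h
    split_ifs at h with hE
    · have hd : 0 ≤ dist p x.1.node := dist_nonneg
      rcases ih h with h | ⟨y, hy, hyj, h₁, h₂⟩
      · by_cases hj : j = x.2
        · subst hj
          rw [Function.update_self, Option.some_inj] at h
          exact Or.inr ⟨x, List.mem_cons_self, rfl, by linarith, by linarith⟩
        · rw [Function.update_of_ne hj] at h
          exact Or.inl h
      · exact Or.inr ⟨y, List.mem_cons_of_mem _ hy, hyj, by linarith, h₂⟩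
    · exact Or.inl h

/-- The services in `S` are separated by the travel times, and after them the server can be at
`p` at time `t`. -/
structure Reachable (σ : List (Request V)) (p : V) (t : ℝ) (S : Schedule) : Prop where
  done : ∀ i q s, σ[i]? = some q → S i = some s → s + 1 + dist q.node p ≤ t
  apart : ∀ i j p q s t, i ≠ j → σ[i]? = some p → σ[j]? = some q → S i = some s → S j = some t →
    s + 1 + dist p.node q.node ≤ t ∨ t + 1 + dist q.node p.node ≤ s

theorem Reachable.mono {σ : List (Request V)} {p : V} {t u : ℝ} {S : Schedule}
    (h : Reachable σ p t S) (htu : t ≤ u) : Reachable σ p u S :=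
  ⟨fun i q s hq hs => (h.done i q s hq hs).trans htu, h.apart⟩

theorem Reachable.update {σ : List (Request V)} {p : V} {t : ℝ} {S : Schedule}
    (h : Reachable σ p t S) {x : Request V × ℕ} (hx : σ[x.2]? = some x.1) :
    Reachable σ x.1.node (t + dist p x.1.node + 1)
      (Function.update S x.2 (some (t + dist p x.1.node))) := by
  -- Every earlier service leaves time to travel via `p`, hence also directly, to the new node.
  have key : ∀ i q s, σ[i]? = some q → S i = some s →
      s + 1 + dist q.node x.1.node ≤ t + dist p x.1.node := fun i q s hq hs => by
    linarith [h.done i q s hq hs, dist_triangle q.node p x.1.node]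
  constructor
  · intro i q s hq hs
    by_cases hi : i = x.2
    · subst hi
      rw [Function.update_self, Option.some_inj] at hs
      rw [hx, Option.some_inj] at hq
      subst hq hs
      simp
    · rw [Function.update_of_ne hi] at hs
      linarith [key i q s hq hs]
  · intro i j q q' s s' hij hq hq' hs hs'
    by_cases hi : i = x.2
    · subst hi
      rw [Function.update_self, Option.some_inj] at hs
      rw [Function.update_of_ne hij.symm] at hs'
      rw [hx, Option.some_inj] at hq
      subst hq hs
      exact Or.inr (key j q' s' hq' hs')
    · rw [Function.update_of_ne hi] at hs
      by_cases hj : j = x.2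
      · subst hj
        rw [Function.update_self, Option.some_inj] at hs'
        rw [hx, Option.some_inj] at hq'
        subst hq' hs'
        exact Or.inl (key i q s hq hs)
      · rw [Function.update_of_ne hj] at hs'
        exact h.apart i j q q' s s' hij hq hq' hs hs'

theorem Reachable.serveQueue {σ : List (Request V)} {E : ℝ} {ρ : List (Request V × ℕ)} :
    ∀ {p : V} {t : ℝ} {S : Schedule}, Reachable σ p t S → t ≤ E →
      (∀ x ∈ ρ, σ[x.2]? = some x.1) →
      Reachable σ (serveQueue E ρ p t S).1 E (serveQueue E ρ p t S).2 := by
  induction ρ with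
  | nil => intro p t S h htE _; exact h.mono htE
  | cons x ρ ih =>
    intro p t S h htE hρ
    rw [TSPWindows.serveQueue]
    split_ifs with hE
    · exact ih (h.update (hρ x List.mem_cons_self)) hE
        (fun y hy => hρ y (List.mem_cons_of_mem _ hy))
    · exact h.mono htE

omit [MetricSpace V] in
theorem throughput_mono {σ : List (Request V)} {S S' : Schedule}
    (h : ∀ j, (S j).isSome → (S' j).isSome) : throughput σ S ≤ throughput σ S' :=
  Finset.card_le_card (Finset.monotone_filter_right _ fun j _ => h j)

omit [MetricSpace V] in
theorem throughput_update {σ : List (Request V)} {S : Schedule} {j : ℕ} (hj : j < σ.length)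
    (hS : S j = none) (t : ℝ) :
    throughput σ (Function.update S j (some t)) = throughput σ S + 1 := by
  unfold throughput
  rw [← Finset.card_insert_of_notMem (a := j) (by simp [hS])]
  congr 1
  ext i
  by_cases hi : i = j
  · subst hi; simp [hj]
  · simp [hi]

/-- The first `k` requests of a queue are served if there is time for them. -/
theorem throughput_add_le_serveQueue {σ : List (Request V)} {E : ℝ}
    {ρ : List (Request V × ℕ)} :
    ∀ {p : V} {t : ℝ} {S : Schedule} {k : ℕ}, (ρ.map Prod.snd).Nodup →
      (∀ x ∈ ρ, x.2 < σ.length ∧ S x.2 = none) → k ≤ ρ.length →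
      t + pathLength (p :: (ρ.take k).map (fun x => x.1.node)) + k ≤ E →
      throughput σ S + k ≤ throughput σ (serveQueue E ρ p t S).2 := by
  induction ρ with
  | nil =>
    intro p t S k _ _ hk _
    obtain rfl : k = 0 := by simpa using hk
    exact le_rfl
  | cons x ρ ih =>
    intro p t S k hnd hρ hk hE
    cases k with
    | zero => exact throughput_mono fun j => serveQueue_isSome
    | succ k =>
      simp only [List.take_succ_cons, List.map_cons, pathLength, Nat.cast_add, Nat.cast_one] at hE
      have hnn := pathLength_nonneg (x.1.node :: (ρ.take k).map (fun x => x.1.node))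
      have hk0 : (0 : ℝ) ≤ k := k.cast_nonneg
      rw [serveQueue, if_pos (by linarith)]
      rw [List.map_cons, List.nodup_cons] at hnd
      have hx := hρ x List.mem_cons_self
      have := ih (p := x.1.node) (t := t + dist p x.1.node + 1)
        (S := Function.update S x.2 (some (t + dist p x.1.node))) (k := k) hnd.2 ?_
        (by simpa using hk) (by linarith)
      · rw [throughput_update hx.1 hx.2] at this
        omega
      · intro y hy
        have hy' := hρ y (List.mem_cons_of_mem _ hy)
        refine ⟨hy'.1, ?_⟩
        rw [Function.update_of_ne, hy'.2]
        rintro h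
        exact hnd.1 (h ▸ List.mem_map_of_mem hy)

/-! ### Pending requests and the plan -/

theorem mem_pending {σ : List (Request V)} {S : Schedule} {ℓ : ℕ} {x : Request V × ℕ} :
    x ∈ pending σ S ℓ ↔ σ[x.2]? = some x.1 ∧ x.1.r ≤ phaseLength V * (ℓ : ℝ) ∧ S x.2 = none ∧
      phaseLength V * ((ℓ : ℝ) + 1) ≤ decreasedDeadline x.1 := by
  rw [pending, List.mem_filter, decide_eq_true_eq, List.mem_zipIdx_iff_getElem?]

theorem pending_map_snd_sorted (σ : List (Request V)) (S : Schedule) (ℓ : ℕ) :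
    (pending σ S ℓ).Pairwise (fun x y => x.2 < y.2) := by
  refine List.Pairwise.filter _ ?_
  rw [← List.pairwise_map (f := Prod.snd) (R := (· < ·)), List.zipIdx_map_snd]
  exact List.pairwise_lt_range'

omit [MetricSpace V] in
theorem mem_atNode {R : List (Request V × ℕ)} {v : V} {x : Request V × ℕ} :
    x ∈ atNode R v ↔ x ∈ R ∧ x.1.node = v := by
  simp [atNode]

omit [MetricSpace V] in
theorem mem_plan_subset {solve : (V → ℕ) → List V} {R : List (Request V × ℕ)}
    {x : Request V × ℕ} (h : x ∈ plan solve R) : x ∈ R := by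
  obtain ⟨v, -, hv⟩ := List.mem_flatMap.1 h
  exact (mem_atNode.1 hv).1

omit [MetricSpace V] in
theorem length_plan (solve : (V → ℕ) → List V) (R : List (Request V × ℕ)) :
    (plan solve R).length =
      prize (fun v => (atNode R v).length) (solve fun v => (atNode R v).length) := by
  simp [plan, prize, List.length_flatMap]

omit [MetricSpace V] in
theorem map_node_plan (solve : (V → ℕ) → List V) (R : List (Request V × ℕ)) :
    (plan solve R).map (fun x => x.1.node) =
      (solve fun v => (atNode R v).length).flatMap
        (fun v => List.replicate (atNode R v).length v) := by
  rw [plan, List.map_flatMap]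
  congr 1
  funext v
  refine List.eq_replicate_iff.2 ⟨by simp, ?_⟩
  intro b hb
  obtain ⟨x, hx, rfl⟩ := List.mem_map.1 hb
  exact (mem_atNode.1 hx).2

/-- A number determines its request and hence its node, and a path of distinct nodes visits that
node only once. -/
theorem nodup_map_snd_plan {solve : (V → ℕ) → List V} {σ : List (Request V)} {S : Schedule}
    {ℓ : ℕ} (h : (solve fun v => (atNode (pending σ S ℓ) v).length).Nodup) :
    ((plan solve (pending σ S ℓ)).map Prod.snd).Nodup := by
  have hinj : ∀ x ∈ plan solve (pending σ S ℓ), ∀ y ∈ plan solve (pending σ S ℓ),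
      x.2 = y.2 → x = y := by
    intro x hx y hy hxy
    have h₁ := (mem_pending.1 (mem_plan_subset hx)).1
    have h₂ := (mem_pending.1 (mem_plan_subset hy)).1
    rw [hxy, h₂, Option.some_inj] at h₁
    exact Prod.ext h₁.symm hxy
  refine List.Nodup.map_on hinj ?_
  have hnd : (pending σ S ℓ).Nodup :=
    (pending_map_snd_sorted σ S ℓ).imp fun hlt heq => hlt.ne (congrArg Prod.snd heq)
  refine List.nodup_flatMap.2 ⟨fun v _ => hnd.filter _, h.imp ?_⟩
  intro v w hvw x hv hw
  exact hvw ((mem_atNode.1 hv).2.symm.trans (mem_atNode.1 hw).2)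

/-! ### The states of the algorithm -/

section State

variable {solve : (V → ℕ) → List V} {v₀ : V} {σ τ : List (Request V)}

theorem phaseLength_nonneg : 0 ≤ phaseLength V :=
  mul_nonneg (by norm_num) Metric.diam_nonneg

theorem state_succ (ℓ : ℕ) : state solve v₀ σ (ℓ + 1) =
    serveQueue (phaseLength V * ((ℓ : ℝ) + 1))
      (plan solve (pending σ (state solve v₀ σ ℓ).2 ℓ))
      (state solve v₀ σ ℓ).1 (phaseLength V * (ℓ : ℝ)) (state solve v₀ σ ℓ).2 := rfl

/-- Only unserved requests are pending, so a later phase never overwrites a recorded service. -/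
theorem state_eq_some_mono {ℓ m : ℕ} (h : ℓ ≤ m) {j : ℕ} {t : ℝ}
    (hj : (state solve v₀ σ ℓ).2 j = some t) : (state solve v₀ σ m).2 j = some t := by
  induction m, h using Nat.le_induction with
  | base => exact hj
  | succ m _ ih =>
    rw [state_succ, serveQueue_of_notMem, ih]
    rintro x hx rfl
    have := (mem_pending.1 (mem_plan_subset hx)).2.2.1
    rw [ih] at this
    cases this

theorem orientWindow_eq_some_iff {j : ℕ} {t : ℝ} :
    orientWindow solve v₀ σ j = some t ↔ ∃ ℓ, (state solve v₀ σ ℓ).2 j = some t := by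
  unfold orientWindow
  constructor
  · intro h
    split_ifs at h with hex
    exact ⟨_, h⟩
  · rintro ⟨ℓ, hℓ⟩
    have hex : ∃ ℓ, ((state solve v₀ σ ℓ).2 j).isSome := ⟨ℓ, by simp [hℓ]⟩
    rw [dif_pos hex]
    obtain ⟨s, hs⟩ := Option.isSome_iff_exists.1 (Nat.find_spec hex)
    have hle : Nat.find hex ≤ ℓ := Nat.find_min' hex (by rw [hℓ]; rfl)
    rw [hs, ← state_eq_some_mono hle hs, hℓ]

/-- Every recorded service takes place in a phase in which the request was pending. -/
theorem exists_phase_of_state_eq_some {ℓ j : ℕ} {t : ℝ}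
    (h : (state solve v₀ σ ℓ).2 j = some t) :
    ∃ m q, (state solve v₀ σ (m + 1)).2 j = some t ∧
      (q, j) ∈ pending σ (state solve v₀ σ m).2 m ∧ phaseLength V * (m : ℝ) ≤ t ∧
      t + 1 ≤ phaseLength V * ((m : ℝ) + 1) := by
  induction ℓ with
  | zero => cases h
  | succ ℓ ih =>
    have h' := h
    rw [state_succ] at h'
    rcases serveQueue_eq_some h' with h' | ⟨x, hx, rfl, h₁, h₂⟩
    · exact ih h'
    · exact ⟨ℓ, x.1, h, mem_plan_subset hx, h₁, h₂⟩

theorem reachable_state (ℓ : ℕ) : Reachable σ (state solve v₀ σ ℓ).1 (phaseLength V * (ℓ : ℝ))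
    (state solve v₀ σ ℓ).2 := by
  induction ℓ with
  | zero => constructor <;> simp [state]
  | succ ℓ ih =>
    rw [state_succ]
    push_cast
    refine ih.serveQueue ?_ fun x hx => (mem_pending.1 (mem_plan_subset hx)).1
    exact mul_le_mul_of_nonneg_left (by linarith) phaseLength_nonneg

theorem decreasedDeadline_le (q : Request V) : decreasedDeadline q ≤ q.d := by
  have hd : 0 ≤ q.d := Nat.cast_nonneg _
  rcases (phaseLength_nonneg (V := V)).eq_or_lt with h | h
  -- Phases of length zero: the decreased deadline is `0`.
  · simpa [decreasedDeadline, ← h] using hd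
  · rw [decreasedDeadline, mul_comm, ← le_div_iff₀ h]
    exact Nat.floor_le (div_nonneg hd h.le)

theorem valid_orientWindow : Valid σ (orientWindow solve v₀ σ) := by
  constructor
  · intro j t h
    obtain ⟨ℓ, hℓ⟩ := orientWindow_eq_some_iff.1 h
    obtain ⟨m, q, -, hq, h₁, h₂⟩ := exists_phase_of_state_eq_some hℓ
    obtain ⟨hσ, hr, -, hd⟩ := mem_pending.1 hq
    exact ⟨q, hσ, hr.trans h₁, (h₂.trans hd).trans (decreasedDeadline_le q)⟩
  · intro i j p q s t hij hp hq hs ht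
    obtain ⟨ℓ, hℓ⟩ := orientWindow_eq_some_iff.1 hs
    obtain ⟨m, hm⟩ := orientWindow_eq_some_iff.1 ht
    exact (reachable_state (max ℓ m)).apart i j p q s t hij hp hq
      (state_eq_some_mono (le_max_left _ _) hℓ) (state_eq_some_mono (le_max_right _ _) hm)

/-! ### The algorithm is online -/

omit [MetricSpace V] in
theorem AgreeUpTo.symm {T : ℝ} (h : AgreeUpTo T σ τ) : AgreeUpTo T τ σ :=
  fun j q hq => (h j q hq).symm

/-- Both lists have the same members and are strictly sorted by number, so they agree as lists, as a
deterministic plan requires. -/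
theorem AgreeUpTo.pending_eq {T : ℝ} (h : AgreeUpTo T σ τ) (S : Schedule) {ℓ : ℕ}
    (hℓ : phaseLength V * (ℓ : ℝ) ≤ T) : pending σ S ℓ = pending τ S ℓ := by
  refine List.Perm.eq_of_pairwise (le := fun x y => x.2 < y.2) ?_
    (pending_map_snd_sorted σ S ℓ) (pending_map_snd_sorted τ S ℓ) ?_
  · intro a b _ _ h₁ h₂
    exact absurd h₁ h₂.asymm
  · refine (List.perm_ext_iff_of_nodup ?_ ?_).2 ?_
    · exact (pending_map_snd_sorted σ S ℓ).imp fun hlt heq => hlt.ne (congrArg Prod.snd heq)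
    · exact (pending_map_snd_sorted τ S ℓ).imp fun hlt heq => hlt.ne (congrArg Prod.snd heq)
    · intro x
      rw [mem_pending, mem_pending]
      refine and_congr_left fun hx => h _ _ (hx.1.trans hℓ)

theorem AgreeUpTo.state_eq {T : ℝ} (h : AgreeUpTo T σ τ) {ℓ : ℕ}
    (hℓ : phaseLength V * (ℓ : ℝ) ≤ T) :
    state solve v₀ σ (ℓ + 1) = state solve v₀ τ (ℓ + 1) := by
  induction ℓ with
  | zero =>
    rw [state_succ, state_succ, h.pending_eq _ hℓ]
    rfl
  | succ ℓ ih =>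
    rw [state_succ (ℓ + 1), state_succ (σ := τ) (ℓ + 1), h.pending_eq _ hℓ, ih]
    refine le_trans (mul_le_mul_of_nonneg_left ?_ phaseLength_nonneg) hℓ
    push_cast
    linarith

theorem isOnline_orientWindow : IsOnline (orientWindow solve v₀) := by
  have key : ∀ (T : ℝ) (σ τ : List (Request V)), AgreeUpTo T σ τ → ∀ (j : ℕ) (t : ℝ), t ≤ T →
      orientWindow solve v₀ σ j = some t → orientWindow solve v₀ τ j = some t := by
    intro T σ τ h j t ht hj
    obtain ⟨ℓ, hℓ⟩ := orientWindow_eq_some_iff.1 hj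
    obtain ⟨m, q, hm, -, h₁, -⟩ := exists_phase_of_state_eq_some hℓ
    -- The service at `t` belongs to a phase that begins no later than `t ≤ T`.
    rw [h.state_eq (h₁.trans ht)] at hm
    exact orientWindow_eq_some_iff.2 ⟨_, hm⟩
  exact fun T σ τ h j t ht => ⟨key T σ τ h j t ht, key T τ σ h.symm j t ht⟩

/-! ### Competitiveness -/

/-- The path along pending requests that some valid schedule starts to serve within `Δ(G)` time
units is a feasible solution of the orienteering problem. -/
theorem exists_orienteeringPath {S O : Schedule} (hO : Valid σ O) {ℓ : ℕ} {N : Finset ℕ}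
    {B b : ℝ} (hB : 0 ≤ B)
    (hN : ∀ j ∈ N, ∃ q t, (q, j) ∈ pending σ S ℓ ∧ O j = some t ∧ b ≤ t ∧ t < b + B) :
    (N.card : ℝ) < B + 1 ∧ ∃ l : List V, OrienteeringPath B l ∧
      N.card ≤ prize (fun v => (atNode (pending σ S ℓ) v).length) l := by
  rcases N.eq_empty_or_nonempty with rfl | hne
  · refine ⟨by simpa using by linarith, [], ⟨List.nodup_nil, hB⟩, by simp⟩
  obtain ⟨i, hi⟩ := hne
  have : Nonempty (Request V) := ⟨(hN i hi).choose⟩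
  have hne : N.Nonempty := ⟨i, hi⟩
  choose! q f hq hf hfb hfB using hN
  set le : ℕ → ℕ → Bool := fun i j => decide (f i ≤ f j) with hle
  set L := N.toList.mergeSort le
  have hperm : L.Perm N.toList := List.mergeSort_perm _ _
  have hmem : ∀ j, j ∈ L ↔ j ∈ N := fun j => hperm.mem_iff.trans Finset.mem_toList
  have hlen : L.length = N.card := by rw [hperm.length_eq, Finset.length_toList]
  have hsort : L.Pairwise (fun i j => le i j = true) := by
    refine List.pairwise_mergeSort ?_ ?_ _
    · intro i j k hij hjk
      simp only [hle, decide_eq_true_eq] at *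
      exact hij.trans hjk
    · intro i j
      simpa [hle] using le_total (f i) (f j)
  have hnd : L.Nodup := hperm.nodup_iff.2 N.nodup_toList
  have hpair : L.Pairwise (fun i j => f i + 1 + dist (q i).node (q j).node ≤ f j) := by
    refine List.Pairwise.imp_of_mem ?_ (hsort.and hnd)
    rintro i j hi hj ⟨hij, hne⟩
    rw [hmem] at hi hj
    have hij : f i ≤ f j := by simpa [hle] using hij
    rcases hO.2 i j _ _ _ _ hne (mem_pending.1 (hq i hi)).1 (mem_pending.1 (hq j hj)).1
      (hf i hi) (hf j hj) with h | h
    · exact h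
    · have := dist_nonneg (x := (q j).node) (y := (q i).node)
      linarith
  obtain ⟨a, L', hcons⟩ : ∃ a L', L = a :: L' := by
    refine List.exists_cons_of_ne_nil fun h => ?_
    rw [h] at hlen
    exact hne.card_pos.ne hlen
  -- The last start lies strictly inside the window; this makes the cardinality bound strict.
  obtain ⟨E, hEB, hE⟩ : ∃ E, E < b + B ∧ ∀ i ∈ L, f i ≤ E := by
    obtain ⟨m, hm, hmax⟩ := N.exists_max_image f hne
    exact ⟨f m, hfB m hm, fun i hi => hmax i ((hmem i).1 hi)⟩
  have hlenpath := add_length_add_pathLength_le (g := fun i => (q i).node) (E := E)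
    (hcons ▸ hpair) (hcons ▸ hE)
  rw [← hcons] at hlenpath
  have ha : b ≤ f a := hfb a ((hmem a).1 (hcons ▸ List.mem_cons_self))
  have hcard : (N.card : ℝ) = L'.length + 1 := by
    rw [← hlen, hcons, List.length_cons]; push_cast; rfl
  have hnn := pathLength_nonneg (L.map fun i => (q i).node)
  have hL'0 : (0 : ℝ) ≤ L'.length := Nat.cast_nonneg _
  -- The schedule may return to a node. Dropping repeats only shortens the path and loses no prize,
  -- as a node counts all its pending requests.
  refine ⟨by linarith, (L.map fun i => (q i).node).dedup, ⟨List.nodup_dedup _, ?_⟩, ?_⟩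
  · refine (pathLength_mono (List.dedup_sublist _)).trans ?_
    linarith
  · set l := (L.map fun i => (q i).node).dedup with hl
    have hsub : N ⊆ ((l.flatMap fun v => atNode (pending σ S ℓ) v).map Prod.snd).toFinset := by
      intro j hj
      rw [List.mem_toFinset, List.mem_map]
      refine ⟨(q j, j), List.mem_flatMap.2 ⟨(q j).node, ?_, mem_atNode.2 ⟨hq j hj, rfl⟩⟩, rfl⟩
      rw [hl, List.mem_dedup, List.mem_map]
      exact ⟨j, (hmem j).2 hj, rfl⟩
    refine (Finset.card_le_card hsub).trans ((List.toFinset_card_le _).trans ?_)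
    simp [prize, List.length_flatMap]

/-- A request with laxity greater than three phases that can be served at time `t` is available
during a whole phase that is not far from `t`. -/
theorem exists_phase_near (hΔ : 0 < diameter V) {q : Request V} {t : ℝ}
    (hq : 9 * diameter V < q.d - q.r) (hr : q.r ≤ t) (hd : t + 1 ≤ q.d) :
    ∃ ℓ : ℕ, q.r ≤ phaseLength V * (ℓ : ℝ) ∧
      phaseLength V * ((ℓ : ℝ) + 1) ≤ decreasedDeadline q ∧
      phaseLength V * ((ℓ : ℝ) - 1) ≤ t ∧ t < phaseLength V * ((ℓ : ℝ) - 1) + 9 * diameter V := by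
  have hKdef : phaseLength V = 3 * diameter V := rfl
  set K := phaseLength V with hK
  have hK0 : 0 < K := by rw [hKdef]; positivity
  have hr0 : 0 < q.r := Nat.cast_pos.2 q.release.pos
  have hdec : ∀ ℓ : ℕ, K * ((ℓ : ℝ) + 1) ≤ q.d → K * ((ℓ : ℝ) + 1) ≤ decreasedDeadline q := by
    intro ℓ h
    rw [decreasedDeadline, ← hK]
    refine mul_le_mul_of_nonneg_left ?_ hK0.le
    have : ℓ + 1 ≤ ⌊q.d / K⌋₊ := by
      refine Nat.le_floor ?_
      rw [le_div_iff₀ hK0, mul_comm]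
      push_cast
      exact h
    exact_mod_cast this
  have hm₁ : K * (⌊t / K⌋₊ : ℝ) ≤ t := by
    rw [mul_comm, ← le_div_iff₀ hK0]
    exact Nat.floor_le (by positivity [hr0.trans_le hr])
  have hm₂ : t < K * ((⌊t / K⌋₊ : ℝ) + 1) := by
    rw [mul_comm, ← div_lt_iff₀ hK0]
    exact Nat.lt_floor_add_one _
  generalize ⌊t / K⌋₊ = m at hm₁ hm₂
  -- With `t` in phase `m`: a request released after that phase begins uses phase `m + 1`, one
  -- expiring before it ends uses phase `m - 1`, and any other uses `m` itself.
  by_cases h₁ : K * (m : ℝ) < q.r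
  · refine ⟨m + 1, ?_, hdec _ ?_, ?_, ?_⟩ <;> push_cast <;> nlinarith
  push Not at h₁
  by_cases h₂ : q.d < K * ((m : ℝ) + 1)
  -- Phase `0` is excluded because the deadline exceeds `3K`.
  · obtain ⟨ℓ, rfl⟩ : ∃ ℓ, m = ℓ + 1 := by
      refine Nat.exists_eq_succ_of_ne_zero ?_
      rintro rfl
      push_cast at h₂
      linarith
    push_cast at *
    refine ⟨ℓ, ?_, hdec _ ?_, ?_, ?_⟩ <;> nlinarith
  push Not at h₂
  exact ⟨m, h₁, hdec m h₂, by nlinarith, by nlinarith⟩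

variable [Fintype V]

/-- The number of requests that are certainly served in a phase. -/
theorem throughput_state_add_le {c : ℝ}
    (hsolve : IsOrienteeringApprox c (diameter V) solve) (ℓ : ℕ) {k : ℕ}
    (hk : k ≤ (plan solve (pending σ (state solve v₀ σ ℓ).2 ℓ)).length)
    (hkΔ : (k : ℝ) ≤ diameter V ∨ k = 1 ∧ 1 / 2 ≤ diameter V) :
    throughput σ (state solve v₀ σ ℓ).2 + k ≤ throughput σ (state solve v₀ σ (ℓ + 1)).2 := by
  obtain ⟨hnd, hlen⟩ :=
    (hsolve fun v => (atNode (pending σ (state solve v₀ σ ℓ).2 ℓ) v).length).1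
  rw [state_succ]
  refine throughput_add_le_serveQueue (nodup_map_snd_plan hnd) ?_ hk ?_
  · intro x hx
    obtain ⟨h₁, -, h₂, -⟩ := mem_pending.1 (mem_plan_subset hx)
    exact ⟨(List.getElem?_eq_some_iff.1 h₁).1, h₂⟩
  · have hK : phaseLength V * ((ℓ : ℝ) + 1) = phaseLength V * ℓ + 3 * diameter V := by
      rw [phaseLength]; ring
    rw [hK]
    have hdiam : ∀ (p : V) (l : List V), pathLength (p :: l) ≤ diameter V + pathLength l := by
      intro p l
      cases l with
      | nil => simpa [pathLength] using dist_nonneg.trans (dist_le_diameter p p)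
      | cons a l =>
        simp only [pathLength]
        linarith [dist_le_diameter p a]
    rcases hkΔ with hkΔ | ⟨rfl, hΔ⟩
    -- A prefix of the plan travels at most `Δ` to the path and `Δ` along it, leaving `Δ ≥ k` for
    -- the services.
    · have h₁ := pathLength_cons_mono
        (((List.take_sublist k (plan solve (pending σ (state solve v₀ σ ℓ).2 ℓ))).map
          (fun x => x.1.node))) (state solve v₀ σ ℓ).1
      have h₂ := pathLength_cons_flatMap_replicate
        (fun v => (atNode (pending σ (state solve v₀ σ ℓ).2 ℓ) v).length)
        (solve fun v => (atNode (pending σ (state solve v₀ σ ℓ).2 ℓ) v).length)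
        (state solve v₀ σ ℓ).1
      rw [← map_node_plan] at h₂
      have h₃ := hdiam (state solve v₀ σ ℓ).1
        (solve fun v => (atNode (pending σ (state solve v₀ σ ℓ).2 ℓ) v).length)
      linarith
    -- A single request needs at most `Δ + 1 ≤ 3Δ`; this is where `Δ ≥ 1/2` enters.
    · have h₁ := hdiam (state solve v₀ σ ℓ).1
        (((plan solve (pending σ (state solve v₀ σ ℓ).2 ℓ)).take 1).map (fun x => x.1.node))
      have h₂ : pathLength (((plan solve (pending σ (state solve v₀ σ ℓ).2 ℓ)).take 1).map
          (fun x => x.1.node)) = 0 := by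
        rcases plan solve (pending σ (state solve v₀ σ ℓ).2 ℓ) with _ | ⟨x, l⟩ <;>
          simp [pathLength]
      push_cast
      linarith

/-- The pending requests that a valid schedule starts to serve within `Δ(G)` time units are
bounded by the requests served in the phase. -/
theorem card_le_of_pending {c : ℝ} (hΔ : 1 / 2 ≤ diameter V)
    (hsolve : IsOrienteeringApprox c (diameter V) solve) {O : Schedule} (hO : Valid σ O)
    {ℓ : ℕ} {N : Finset ℕ} {b : ℝ}
    (hN : ∀ j ∈ N, ∃ q t, (q, j) ∈ pending σ (state solve v₀ σ ℓ).2 ℓ ∧ O j = some t ∧ b ≤ t ∧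
      t < b + diameter V) :
    (N.card : ℝ) ≤ max c 3 * ((throughput σ (state solve v₀ σ (ℓ + 1)).2 : ℝ) -
      throughput σ (state solve v₀ σ ℓ).2) := by
  obtain ⟨hcard, l, hl, hprize⟩ := exists_orienteeringPath hO (by linarith) hN
  have happ := (hsolve fun v => (atNode (pending σ (state solve v₀ σ ℓ).2 ℓ) v).length).2 l hl
  rw [← length_plan] at happ
  set n := (plan solve (pending σ (state solve v₀ σ ℓ).2 ℓ)).length
  have hNn : (N.card : ℝ) ≤ max c 3 * n := by
    calc (N.card : ℝ) ≤ _ := Nat.cast_le.2 hprize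
      _ ≤ c * n := happ
      _ ≤ max c 3 * n := by gcongr; exact le_max_left c 3
  have hserved : ∀ k : ℕ, k ≤ n → ((k : ℝ) ≤ diameter V ∨ k = 1 ∧ 1 / 2 ≤ diameter V) →
      (k : ℝ) ≤ (throughput σ (state solve v₀ σ (ℓ + 1)).2 : ℝ) -
        throughput σ (state solve v₀ σ ℓ).2 := by
    intro k hk hkΔ
    have := throughput_state_add_le hsolve ℓ hk hkΔ
    have : (throughput σ (state solve v₀ σ ℓ).2 : ℝ) + k ≤
      throughput σ (state solve v₀ σ (ℓ + 1)).2 := by exact_mod_cast this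
    linarith
  have hmax : (3 : ℝ) ≤ max c 3 := le_max_right c 3
  have hfin : ∀ k : ℕ, k ≤ n → ((k : ℝ) ≤ diameter V ∨ k = 1 ∧ 1 / 2 ≤ diameter V) →
      (N.card : ℝ) ≤ max c 3 * k → (N.card : ℝ) ≤ max c 3 *
        ((throughput σ (state solve v₀ σ (ℓ + 1)).2 : ℝ) -
          throughput σ (state solve v₀ σ ℓ).2) := fun k hk hkΔ h =>
    h.trans (mul_le_mul_of_nonneg_left (hserved k hk hkΔ) (by linarith))
  by_cases hnΔ : (n : ℝ) ≤ diameter V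
  · exact hfin n le_rfl (Or.inl hnΔ) hNn
  push Not at hnΔ
  -- The plan is now longer than `Δ`, so the bound `N.card < Δ + 1` is used instead of the
  -- approximation ratio. For `Δ < 1` it gives less than `2`, paid by one service.
  by_cases h1 : diameter V < 1
  · have hn1 : 1 ≤ n := by
      have : (0 : ℝ) < n := by linarith
      exact_mod_cast this
    refine hfin 1 hn1 (Or.inr ⟨rfl, hΔ⟩) ?_
    push_cast
    linarith
  · push Not at h1
    have hf := Nat.floor_le (zero_le_one.trans h1)
    have hf1 : (1 : ℝ) ≤ (⌊diameter V⌋₊ : ℝ) := by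
      exact_mod_cast (Nat.one_le_floor_iff _).2 h1
    have hf2 := Nat.lt_floor_add_one (diameter V)
    refine hfin ⌊diameter V⌋₊ ?_ (Or.inl hf) ?_
    · exact_mod_cast (hf.trans_lt hnΔ).le
    -- The constant `3` comes from `⌊Δ⌋ + 2 ≤ 3⌊Δ⌋`, valid as `⌊Δ⌋ ≥ 1`.
    · have hN2 : (N.card : ℝ) < (⌊diameter V⌋₊ : ℝ) + 2 := by linarith
      have : 3 * (⌊diameter V⌋₊ : ℝ) ≤ max c 3 * ⌊diameter V⌋₊ := by gcongr
      linarith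

theorem opt_le_orientWindow {c : ℝ} (hΔ : 1 / 2 ≤ diameter V)
    (hsolve : IsOrienteeringApprox c (diameter V) solve)
    (hL : ((9 * diameter V : ℝ) : EReal) < minLaxity σ) :
    (opt σ : ℝ) ≤ (9 * max c 3 + 1) * (throughput σ (orientWindow solve v₀ σ) : ℝ) := by
  obtain ⟨O, hO, hopt⟩ := exists_valid_throughput_eq_opt σ
  rw [← hopt]
  have hΔ0 : 0 < diameter V := by linarith
  have hlax : ∀ q ∈ σ, 9 * diameter V < q.d - q.r := by
    intro q hq
    exact EReal.coe_lt_coe_iff.1 (hL.trans_le (iInf₂_le q hq))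
  set A := orientWindow solve v₀ σ with hA
  set I := (Finset.range σ.length).filter (fun j => (O j).isSome)
  have hnone : ∀ j, A j = none → ∀ ℓ, (state solve v₀ σ ℓ).2 j = none := by
    intro j hj ℓ
    refine Option.eq_none_iff_forall_ne_some.2 fun t ht => ?_
    rw [hA, orientWindow_eq_some_iff.2 ⟨ℓ, ht⟩] at hj
    cases hj
  -- The charge: `ℓ` is the phase and `k` the window of length `Δ`, counted from one phase before
  -- `ℓ`.
  have hex : ∀ j ∈ I, ∃ ℓ k : ℕ, A j = none → k < 9 ∧ ∃ q t,
      (q, j) ∈ pending σ (state solve v₀ σ ℓ).2 ℓ ∧ O j = some t ∧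
      phaseLength V * ((ℓ : ℝ) - 1) + k * diameter V ≤ t ∧
      t < phaseLength V * ((ℓ : ℝ) - 1) + k * diameter V + diameter V := by
    intro j hj
    obtain ⟨t, ht⟩ := Option.isSome_iff_exists.1 (Finset.mem_filter.1 hj).2
    obtain ⟨q, hq, hr, hd⟩ := hO.1 j t ht
    obtain ⟨ℓ, h₁, h₂, h₃, h₄⟩ :=
      exists_phase_near hΔ0 (hlax q (List.mem_of_getElem? hq)) hr hd
    set u := t - phaseLength V * ((ℓ : ℝ) - 1)
    have hk₁ : (⌊u / diameter V⌋₊ : ℝ) * diameter V ≤ u := by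
      rw [← le_div_iff₀ hΔ0]
      exact Nat.floor_le (div_nonneg (by linarith) hΔ0.le)
    have hk₂ : u < ((⌊u / diameter V⌋₊ : ℝ) + 1) * diameter V := by
      rw [← div_lt_iff₀ hΔ0]
      exact Nat.lt_floor_add_one _
    refine ⟨ℓ, ⌊u / diameter V⌋₊, fun hj => ⟨?_, q, t, ?_, ht, ?_, ?_⟩⟩
    · rw [Nat.floor_lt (div_nonneg (by linarith) hΔ0.le), div_lt_iff₀ hΔ0]
      push_cast
      linarith
    · exact mem_pending.2 ⟨hq, h₁, hnone j hj ℓ, h₂⟩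
    · linarith
    · linarith
  choose! ph pc hpp using hex
  set M := I.sup ph + 1
  set N : ℕ → ℕ → Finset ℕ := fun ℓ k => I.filter (fun j => A j = none ∧ ph j = ℓ ∧ pc j = k)
  set served := (Finset.range σ.length).filter (fun j => (A j).isSome)
  have hsub : I ⊆ served ∪
      (Finset.range M).biUnion (fun ℓ => (Finset.range 9).biUnion (fun k => N ℓ k)) := by
    intro j hj
    rw [Finset.mem_union]
    by_cases hjA : A j = none
    · right
      simp only [Finset.mem_biUnion, Finset.mem_range]
      exact ⟨ph j, Nat.lt_succ_of_le (Finset.le_sup hj), pc j, (hpp j hj hjA).1,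
        Finset.mem_filter.2 ⟨hj, hjA, rfl, rfl⟩⟩
    · left
      exact Finset.mem_filter.2 ⟨(Finset.mem_filter.1 hj).1, Option.isSome_iff_ne_none.2 hjA⟩
  have hN : ∀ ℓ k, ((N ℓ k).card : ℝ) ≤ max c 3 *
      ((throughput σ (state solve v₀ σ (ℓ + 1)).2 : ℝ) - throughput σ (state solve v₀ σ ℓ).2) := by
    intro ℓ k
    refine card_le_of_pending hΔ hsolve hO
      (b := phaseLength V * ((ℓ : ℝ) - 1) + k * diameter V) ?_
    intro j hj
    obtain ⟨hjI, hjA, rfl, rfl⟩ := Finset.mem_filter.1 hj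
    exact (hpp j hjI hjA).2
  have hcard : (I.card : ℝ) ≤ (served.card : ℝ) +
      ∑ ℓ ∈ Finset.range M, ∑ k ∈ Finset.range 9, ((N ℓ k).card : ℝ) := by
    have h := (Finset.card_le_card hsub).trans ((Finset.card_union_le _ _).trans
      (Nat.add_le_add_left (Finset.card_biUnion_le.trans
        (Finset.sum_le_sum fun ℓ _ => Finset.card_biUnion_le)) _))
    exact_mod_cast h
  have hsum : ∑ ℓ ∈ Finset.range M, ∑ k ∈ Finset.range 9, ((N ℓ k).card : ℝ) ≤
      9 * max c 3 * (throughput σ (state solve v₀ σ M).2 : ℝ) := by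
    have h₀ : throughput σ (state solve v₀ σ 0).2 = 0 := by simp [throughput, state]
    calc ∑ ℓ ∈ Finset.range M, ∑ k ∈ Finset.range 9, ((N ℓ k).card : ℝ)
        ≤ ∑ ℓ ∈ Finset.range M, 9 * max c 3 *
          ((throughput σ (state solve v₀ σ (ℓ + 1)).2 : ℝ) -
            throughput σ (state solve v₀ σ ℓ).2) := by
          refine Finset.sum_le_sum fun ℓ _ => ?_
          refine (Finset.sum_le_sum fun k _ => hN ℓ k).trans ?_
          simp [mul_assoc]
      _ = _ := by
          -- The gains of the phases telescope.
          rw [← Finset.mul_sum,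
            Finset.sum_range_sub (fun ℓ => (throughput σ (state solve v₀ σ ℓ).2 : ℝ)), h₀]
          simp
  have hle : (throughput σ (state solve v₀ σ M).2 : ℝ) ≤ throughput σ A := by
    refine Nat.cast_le.2 (throughput_mono fun j hj => ?_)
    obtain ⟨t, ht⟩ := Option.isSome_iff_exists.1 hj
    rw [hA, orientWindow_eq_some_iff.2 ⟨M, ht⟩]
    rfl
  have hmax : (3 : ℝ) ≤ max c 3 := le_max_right c 3
  have hmul : 9 * max c 3 * (throughput σ (state solve v₀ σ M).2 : ℝ) ≤
      9 * max c 3 * (throughput σ A : ℝ) := mul_le_mul_of_nonneg_left hle (by linarith)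
  change (I.card : ℝ) ≤ (9 * max c 3 + 1) * (served.card : ℝ)
  change _ ≤ 9 * max c 3 * (served.card : ℝ) at hmul
  linarith

end State

end TSPWindows

theorem mainTheorem5 {V : Type*} [Fintype V] [MetricSpace V]
    (hΔ : 1 / 2 ≤ TSPWindows.diameter V)
    (c : ℝ) (solve : (V → ℕ) → List V)
    (hsolve : TSPWindows.IsOrienteeringApprox c (TSPWindows.diameter V) solve) (v₀ : V) :
    TSPWindows.IsOnline (TSPWindows.orientWindow solve v₀) ∧
    ∀ σ : List (TSPWindows.Request V),
      ((9 * TSPWindows.diameter V : ℝ) : EReal) < TSPWindows.minLaxity σ →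
        TSPWindows.Valid σ (TSPWindows.orientWindow solve v₀ σ) ∧
        (TSPWindows.opt σ : ℝ) ≤ (9 * max c 3 + 1) *
          (TSPWindows.throughput σ (TSPWindows.orientWindow solve v₀ σ) : ℝ) ∧
        (c ≤ 3 → (TSPWindows.opt σ : ℝ) ≤
          28 * (TSPWindows.throughput σ (TSPWindows.orientWindow solve v₀ σ) : ℝ)) := by
  refine ⟨TSPWindows.isOnline_orientWindow, fun σ hL => ⟨TSPWindows.valid_orientWindow,
    TSPWindows.opt_le_orientWindow hΔ hsolve hL, fun hc => ?_⟩⟩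
  have h := TSPWindows.opt_le_orientWindow (v₀ := v₀) hΔ hsolve hL
  rw [max_eq_right hc] at h
  norm_num at h
  exact h
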